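/- Let $X$ be a Tychonoff space and let $C(X)$ be the set of continuous real-valued functions on $X$, a group under pointwise addition. Let $C_p(X)$ be $C(X)$ with the topology of pointwise convergence. Let $C_m(X)$ be $C(X)$ with the $m$-topology, in which a local base at $f$ consists of the sets $\{g\in C(X): |g(x)-f(x)|<\varepsilon(x)\text{ for all }x\in X\}$, where $\varepsilon\in C(X)$ is strictly positive. A topological group $G$ (written additively) is *M-bounded* if for each sequence $(U_n)_{n\in\mathbb N}$ of neighborhoods of the neutral element there are finite sets $A_n\subset G$ with $G=\bigcup_n (A_n+U_n)$. It is *H-bounded* if for each such sequence there are finite sets $A_n\subset G$ such that every $x\in G$ belongs to all but finitely many of the sets $A_n+U_n$. It is *strictly M-bounded* (*strictly H-bounded*) if player TWO has a winning strategy in the following game: in round $n\in\mathbb N$ player ONE chooses a neighborhood $U_n$ of the neutral element and TWO responds with a finite set $A_n\subset G$; TWO wins the play if $G=\bigcup_n(A_n+U_n)$ (respectively, if every $x\in G$ belongs to all but finitely many of the sets $A_n+U_n$). A space $Y$ is *strictly Fréchet–Urysohn* (respectively has *countable strong fan tightness*, *countable fan tightness*) if for every $y\in Y$ and all sets $A_n\subset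 Y$ $(n\in\mathbb N)$ with $y\in\bigcap_n\overline{A_n}$ there are points $z_n\in A_n$ with $z_n\to y$ (respectively points $z_n\in A_n$ with $y\in\overline{\{z_n:n\in\mathbb N\}}$, finite sets $B_n\subset A_n$ with $y\in\overline{\bigcup_n B_n}$). It has *countable tightness* if $y\in\overline A$, $A\subset Y$, always implies $y\in\overline B$ for some countable $B\subset A$. It is *Čech-complete* if it is Tychonoff and a $G_\delta$ set in its Stone–Čech compactification, and *hereditarily Baire* if each of its closed subspaces is a Baire space. It is *pseudocompact* if every continuous real-valued function on it is bounded. **Theorem.** For every Tychonoff space $X$ the following are equivalent: 1. $C_p(X)$ is strictly H-bounded; 2. $C_p(X)$ is H-bounded; 3. $C_p(X)$ is strictly M-bounded; 4. $C_p(X)$ is M-bounded; 5. $X$ is pseudocompact; 6. $C_m(X)$ is first countable; 7. $C_m(X)$ is strictly Fréchet–Urysohn; 8. $C_m(X)$ has countable strong fan tightness; 9. $C_m(X)$ has countable fan tightness; 10. $C_m(X)$ has countable tightness; 11. $C_m(X)$ is completely metrizable; 12. $C_m(X)$ is Čech-complete; 13. $C_m(X)$ is hereditarily Baire. -/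

import Mathlib

open Filter Topology
open scoped Pointwise

section Boundedness

variable (G : Type*) [AddGroup G] [TopologicalSpace G]

/-- Menger-boundedness (M-boundedness) of a group, written additively. -/
def MBounded : Prop :=
  ∀ U : ℕ → Set G, (∀ n, U n ∈ 𝓝 (0 : G)) →
    ∃ A : ℕ → Finset G, ⋃ n, ((A n : Set G) + U n) = Set.univ

/-- Hurewicz-boundedness (H-boundedness) of a group, written additively. -/
def HBounded : Prop :=
  ∀ U : ℕ → Set G, (∀ n, U n ∈ 𝓝 (0 : G)) →
    ∃ A : ℕ → Finset G, ∀ x : G, ∀ᶠ n in atTop, x ∈ (A n : Set G) + U n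

/-- Strict M-boundedness: TWO has a winning strategy in the game in which, in round `n`, ONE plays
a neighbourhood `U n` of the neutral element, TWO answers with a finite set `A n`, and TWO wins if
the sets `A n + U n` cover `G`. A strategy `σ` of TWO gives the answer to the list
`[U 0, …, U n]` of the moves that ONE has made so far. -/
def StrictlyMBounded : Prop :=
  ∃ σ : List (Set G) → Finset G, ∀ U : ℕ → Set G, (∀ n, U n ∈ 𝓝 (0 : G)) →
    ⋃ n, ((σ ((List.range (n + 1)).map U) : Set G) + U n) = Set.univ

/-- Strict H-boundedness: the same game, in which TWO wins if every point of `G` belongs to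
all but finitely many of the sets `A n + U n`. -/
def StrictlyHBounded : Prop :=
  ∃ σ : List (Set G) → Finset G, ∀ U : ℕ → Set G, (∀ n, U n ∈ 𝓝 (0 : G)) →
    ∀ x : G, ∀ᶠ n in atTop, x ∈ (σ ((List.range (n + 1)).map U) : Set G) + U n

end Boundedness

section TopologicalProperties

variable (Y : Type*) [TopologicalSpace Y]

/-- Every continuous real-valued function is bounded. -/
def Pseudocompact : Prop :=
  ∀ f : C(Y, ℝ), ∃ M : ℝ, ∀ y, |f y| ≤ M

/-- If `y` lies in the closure of every `A n`, then some points `z n ∈ A n` converge to `y`. -/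
def StrictlyFrechetUrysohn : Prop :=
  ∀ (y : Y) (A : ℕ → Set Y), (∀ n, y ∈ closure (A n)) →
    ∃ z : ℕ → Y, (∀ n, z n ∈ A n) ∧ Tendsto z atTop (𝓝 y)

def CountableStrongFanTightness : Prop :=
  ∀ (y : Y) (A : ℕ → Set Y), (∀ n, y ∈ closure (A n)) →
    ∃ z : ℕ → Y, (∀ n, z n ∈ A n) ∧ y ∈ closure (Set.range z)

def CountableFanTightness : Prop :=
  ∀ (y : Y) (A : ℕ → Set Y), (∀ n, y ∈ closure (A n)) →
    ∃ B : ℕ → Finset Y, (∀ n, (B n : Set Y) ⊆ A n) ∧ y ∈ closure (⋃ n, (B n : Set Y))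

def CountableTightness : Prop :=
  ∀ (y : Y) (A : Set Y), y ∈ closure A → ∃ B ⊆ A, B.Countable ∧ y ∈ closure B

/-- Čech-completeness: `Y` is Tychonoff and is a `G_δ` set in its Stone–Čech compactification. -/
def CechComplete : Prop :=
  T35Space Y ∧ IsGδ (Set.range (stoneCechUnit : Y → StoneCech Y))

/-- Every closed subspace is a Baire space. -/
def HereditarilyBaire : Prop :=
  ∀ F : Set Y, IsClosed F → BaireSpace F

end TopologicalProperties

section FunctionSpaces

/-- The underlying set of `C_p(X)`. -/
def Cp (X : Type*) [TopologicalSpace X] := C(X, ℝ)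

/-- The underlying set of `C_m(X)`. -/
def Cm (X : Type*) [TopologicalSpace X] := C(X, ℝ)

variable (X : Type*) [TopologicalSpace X]

instance Cp.instFunLike : FunLike (Cp X) X ℝ := inferInstanceAs (FunLike C(X, ℝ) X ℝ)

instance Cm.instFunLike : FunLike (Cm X) X ℝ := inferInstanceAs (FunLike C(X, ℝ) X ℝ)

/-- Pointwise addition. -/
noncomputable instance Cp.instAddCommGroup : AddCommGroup (Cp X) :=
  inferInstanceAs (AddCommGroup C(X, ℝ))

/-- Pointwise addition. -/
noncomputable instance Cm.instAddCommGroup : AddCommGroup (Cm X) :=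
  inferInstanceAs (AddCommGroup C(X, ℝ))

/-- The topology of pointwise convergence. -/
instance Cp.instTopologicalSpace : TopologicalSpace (Cp X) :=
  TopologicalSpace.induced (fun (f : Cp X) (x : X) => f x) Pi.topologicalSpace

variable {X}

/-- The basic neighbourhood `W(f, ε)` of `f` in the `m`-topology. -/
def Cm.W (f : Cm X) (ε : C(X, ℝ)) : Set (Cm X) :=
  {g : Cm X | ∀ x, |g x - f x| < ε x}

/-- The `m`-topology: a set is open if with each `f` it contains some `W(f, ε)`, where `ε` is a
strictly positive continuous function. -/
instance Cm.instTopologicalSpace : TopologicalSpace (Cm X) where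
  IsOpen S := ∀ f ∈ S, ∃ ε : C(X, ℝ), (∀ x, 0 < ε x) ∧ Cm.W f ε ⊆ S
  isOpen_univ _ _ := ⟨1, fun _ => one_pos, Set.subset_univ _⟩
  isOpen_inter S T hS hT f hf := by
    obtain ⟨ε, hε, h⟩ := hS f hf.1
    obtain ⟨δ, hδ, h'⟩ := hT f hf.2
    refine ⟨ε ⊓ δ, fun x => lt_min (hε x) (hδ x), fun g hg => ⟨h fun x => ?_, h' fun x => ?_⟩⟩
    · exact (hg x).trans_le (min_le_left _ _)
    · exact (hg x).trans_le (min_le_right _ _)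
  isOpen_sUnion 𝒮 h𝒮 f hf := by
    obtain ⟨S, hS, hfS⟩ := hf
    obtain ⟨ε, hε, h⟩ := h𝒮 S hS f hfS
    exact ⟨ε, hε, h.trans (Set.subset_sUnion_of_mem hS)⟩

/-- The sets `W(f, ε)` form a local base at `f` in the `m`-topology. -/
theorem Cm.nhds_hasBasis (f : Cm X) :
    (𝓝 f).HasBasis (fun ε : C(X, ℝ) => ∀ x, 0 < ε x) (fun ε => Cm.W f ε) := by
  refine ⟨fun S => ⟨fun hS => ?_, ?_⟩⟩
  · obtain ⟨T, hTS, hT, hf⟩ := mem_nhds_iff.1 hS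
    obtain ⟨ε, hε, h⟩ := hT f hf
    exact ⟨ε, hε, h.trans hTS⟩
  · rintro ⟨ε, hε, h⟩
    refine mem_nhds_iff.2 ⟨Cm.W f ε, h, fun g hg => ?_, fun x => by simpa using hε x⟩
    have hg' : ∀ x, |g x - f x| < ε x := hg
    let f' : C(X, ℝ) := f
    let g' : C(X, ℝ) := g
    refine ⟨ε - |g' - f'|, fun x => sub_pos.2 (hg' x), fun k hk x => ?_⟩
    have h1 : |k x - g x| < ε x - |g x - f x| := hk x
    have h2 := abs_sub_le (k x) (g x) (f x)
    linarith

end FunctionSpaces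

/-! Every condition is tied to pseudocompactness of `X`. If `X` is pseudocompact, strictly positive
continuous functions have positive constant lower bounds, so `Cm X` carries the uniform topology,
which is completely metrizable. Moreover `Cp X` is the union of the sets of functions bounded by
`n`, each coverable by finitely many translates of any neighbourhood of zero, so TWO can deal with
the `n`-th set in round `n`. If `X` is not pseudocompact, some continuous `h` has `h (x n) ≥ n`.
Composing `h` with a fast-growing function on the line (`exists_continuous_pos_dominating`) yields
continuous functions as large, or positive and as small, as desired at all `x n` at once. Diagonal
arguments then refute M-boundedness, countable tightness and hereditary Baireness. -/

section Pseudocompactness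

variable {X : Type*} [TopologicalSpace X]

/-- A continuous function on the line growing faster than a given sequence. -/
theorem exists_continuous_pos_dominating (c : ℕ → ℝ) :
    ∃ φ : C(ℝ, ℝ), (∀ r, 0 < φ r) ∧ ∀ (n : ℕ) (r : ℝ), (n : ℝ) ≤ r → c n ≤ φ r := by
  -- The admissible values at each `r` form a convex set, and one constant is admissible near `r`; a
  -- partition of unity glues these constants. The bound `1` gives positivity.
  have hconv : ∀ r : ℝ, Convex ℝ {y : ℝ | 1 ≤ y ∧ ∀ n : ℕ, (n : ℝ) ≤ r → c n ≤ y} := by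
    intro r
    have : {y : ℝ | 1 ≤ y ∧ ∀ n : ℕ, (n : ℝ) ≤ r → c n ≤ y} =
        Set.Ici 1 ∩ ⋂ (n : ℕ) (_ : (n : ℝ) ≤ r), Set.Ici (c n) := by
      ext y
      simp
    rw [this]
    exact (convex_Ici 1).inter (convex_iInter fun n => convex_iInter fun _ => convex_Ici _)
  obtain ⟨φ, hφ⟩ := exists_continuous_forall_mem_convex_of_local_const hconv fun r => by
    obtain ⟨N, hN⟩ := exists_nat_gt r
    refine ⟨1 + ∑ n ∈ Finset.range N, |c n|, ?_⟩
    filter_upwards [Iio_mem_nhds hN] with s hs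
    refine ⟨le_add_of_nonneg_right (Finset.sum_nonneg fun _ _ => abs_nonneg _), fun n hn => ?_⟩
    have hnN : n ∈ Finset.range N :=
      Finset.mem_range.2 (Nat.cast_lt.1 (lt_of_le_of_lt hn hs))
    have := Finset.single_le_sum (f := fun n => |c n|) (fun _ _ => abs_nonneg _) hnN
    have := le_abs_self (c n)
    linarith
  exact ⟨φ, fun r => one_pos.trans_le (hφ r).1, fun n r => (hφ r).2 n⟩

theorem exists_seq_of_not_pseudocompact (hX : ¬ Pseudocompact X) :
    ∃ (h : C(X, ℝ)) (x : ℕ → X), ∀ n : ℕ, (n : ℝ) ≤ h (x n) := by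
  simp only [Pseudocompact, not_forall, not_exists, not_le] at hX
  obtain ⟨f, hf⟩ := hX
  choose x hx using fun n : ℕ => hf n
  exact ⟨|f|, x, fun n => (hx n).le⟩

theorem Pseudocompact.exists_pos_le (hX : Pseudocompact X) (ε : C(X, ℝ)) (hε : ∀ x, 0 < ε x) :
    ∃ δ > 0, ∀ x, δ ≤ ε x := by
  obtain ⟨M, hM⟩ := hX ⟨fun x => (ε x)⁻¹, ε.continuous.inv₀ fun x => (hε x).ne'⟩
  refine ⟨(max M 1)⁻¹, by positivity, fun x => ?_⟩
  have h1 : (ε x)⁻¹ ≤ max M 1 := ((le_abs_self _).trans (hM x)).trans (le_max_left _ _)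
  exact inv_le_of_inv_le₀ (hε x) h1

end Pseudocompactness

section Boundedness

variable {G : Type*} [AddGroup G] [TopologicalSpace G]

theorem StrictlyHBounded.hBounded (h : StrictlyHBounded G) : HBounded G := by
  obtain ⟨σ, hσ⟩ := h
  exact fun U hU => ⟨_, hσ U hU⟩

theorem StrictlyMBounded.mBounded (h : StrictlyMBounded G) : MBounded G := by
  obtain ⟨σ, hσ⟩ := h
  exact fun U hU => ⟨_, hσ U hU⟩

theorem HBounded.mBounded (h : HBounded G) : MBounded G := by
  intro U hU
  obtain ⟨A, hA⟩ := h U hU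
  exact ⟨A, Set.eq_univ_of_forall fun x => Set.mem_iUnion.2 (hA x).exists⟩

theorem StrictlyHBounded.strictlyMBounded (h : StrictlyHBounded G) : StrictlyMBounded G := by
  obtain ⟨σ, hσ⟩ := h
  exact ⟨σ, fun U hU => Set.eq_univ_of_forall fun x => Set.mem_iUnion.2 (hσ U hU x).exists⟩

end Boundedness

/-! ### Boundedness of `Cp X` and pseudocompactness. -/

section PointwiseConvergence

variable {X : Type*} [TopologicalSpace X]

theorem Cp.exists_finset_of_mem_nhds_zero {U : Set (Cp X)} (hU : U ∈ 𝓝 (0 : Cp X)) :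
    ∃ (F : Finset X) (ε : ℝ), 0 < ε ∧ {f : Cp X | ∀ x ∈ F, |f x| < ε} ⊆ U := by
  rw [nhds_induced, mem_comap] at hU
  obtain ⟨V, hV, hVU⟩ := hU
  rw [nhds_pi, Filter.mem_pi'] at hV
  obtain ⟨F, t, ht, htV⟩ := hV
  choose ε hε hεt using fun x => Metric.mem_nhds_iff.1 (ht x)
  obtain ⟨δ, hδ, hδε⟩ : ∃ δ > 0, ∀ x ∈ F, δ ≤ ε x := by
    rcases F.eq_empty_or_nonempty with rfl | hF
    · exact ⟨1, one_pos, by simp⟩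
    · exact ⟨F.inf' hF ε, (Finset.lt_inf'_iff hF).2 fun x _ => hε x,
        fun x hx => Finset.inf'_le ε hx⟩
  refine ⟨F, δ, hδ, fun f hf => hVU (htV fun x hx => hεt x ?_)⟩
  have h0 : (0 : Cp X) x = 0 := rfl
  rw [Metric.mem_ball, h0, Real.dist_eq, sub_zero]
  exact (hf x hx).trans_le (hδε x hx)

/-- Uniformly bounded functions are covered by finitely many translates of a neighbourhood
of zero. -/
theorem Cp.exists_finset_cover {U : Set (Cp X)} (hU : U ∈ 𝓝 (0 : Cp X)) (M : ℝ) :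
    ∃ A : Finset (Cp X), ∀ f : Cp X, (∀ x, |f x| ≤ M) → f ∈ (A : Set (Cp X)) + U := by
  classical
  obtain ⟨F, ε, hε, hFU⟩ := Cp.exists_finset_of_mem_nhds_zero hU
  let r : Cp X → F → ℝ := fun f x => f x
  -- Only values on the finite set `F` matter, so the question is about a bounded subset of a
  -- finite-dimensional space.
  have hb : TotallyBounded (r '' {f | ∀ x, |f x| ≤ M}) := by
    refine (isCompact_closedBall (0 : F → ℝ) (max M 0)).totallyBounded.subset ?_
    rintro _ ⟨f, hf, rfl⟩
    rw [mem_closedBall_zero_iff, pi_norm_le_iff_of_nonneg (le_max_right _ _)]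
    exact fun x => (hf x).trans (le_max_left _ _)
  obtain ⟨t, ht, htf, hcov⟩ := Metric.finite_approx_of_totallyBounded hb ε hε
  -- The net lies in the image of the restriction map, so it lifts to finitely many functions on
  -- `X`.
  obtain ⟨A, -, hAt⟩ := Set.SurjOn.exists_bijOn_subset ht
  have hA : A.Finite := hAt.finite_iff_finite.2 htf
  obtain rfl := hAt.image_eq
  refine ⟨hA.toFinset, fun f hf => ?_⟩
  obtain ⟨_, ⟨a, ha, rfl⟩, hfa⟩ := Set.mem_iUnion₂.1 (hcov ⟨f, hf, rfl⟩)
  refine Set.mem_add.2 ⟨a, by simpa using ha, -a + f, hFU fun x hx => ?_, by simp⟩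
  have h1 := (dist_pi_lt_iff hε).1 hfa ⟨x, hx⟩
  rw [Real.dist_eq] at h1
  have h2 : (-a + f) x = f x - a x := by
    change -(a x) + f x = _
    ring
  rw [h2]
  exact h1

theorem Pseudocompact.strictlyHBounded_cp (hX : Pseudocompact X) : StrictlyHBounded (Cp X) := by
  classical
  have key : ∀ (U : Set (Cp X)) (n : ℕ), ∃ A : Finset (Cp X), U ∈ 𝓝 (0 : Cp X) →
      ∀ f : Cp X, (∀ x, |f x| ≤ n) → f ∈ (A : Set (Cp X)) + U := by
    intro U n
    by_cases hU : U ∈ 𝓝 (0 : Cp X)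
    · obtain ⟨A, hA⟩ := Cp.exists_finset_cover hU n
      exact ⟨A, fun _ => hA⟩
    · exact ⟨∅, fun h => absurd h hU⟩
  choose A hA using key
  -- TWO needs only ONE's last move and the length of the list, which is `n + 1` in round `n`. The
  -- list is then nonempty, so the default `∅` is never used.
  refine ⟨fun l => A (l.getLastD ∅) l.length, fun U hU f => ?_⟩
  obtain ⟨M, hM⟩ := hX f
  obtain ⟨N, hN⟩ := exists_nat_ge M
  filter_upwards [eventually_ge_atTop N] with n hn
  have h1 : ((List.range (n + 1)).map U).getLastD ∅ = U n := by
    simp [List.range_succ]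
  have h2 : ((List.range (n + 1)).map U).length = n + 1 := by simp
  rw [h1, h2]
  refine hA _ _ (hU n) f fun x => (hM x).trans (hN.trans ?_)
  exact_mod_cast hn.trans n.le_succ

theorem MBounded.pseudocompact (hM : MBounded (Cp X)) : Pseudocompact X := by
  by_contra hX
  obtain ⟨h, x, hx⟩ := exists_seq_of_not_pseudocompact hX
  have hcont : ∀ n, Continuous fun f : Cp X => f (x n) := fun n =>
    (continuous_apply (x n)).comp continuous_induced_dom
  obtain ⟨A, hA⟩ := hM (fun n => {f | |f (x n)| < 1}) fun n => by
    refine ((hcont n).abs.isOpen_preimage _ isOpen_Iio).mem_nhds ?_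
    change |(0 : ℝ)| < 1
    simp
  -- The sum bounds every `a (x n)` with `a ∈ A n`; the extra `1` outweighs the error allowed by the
  -- neighbourhood.
  obtain ⟨φ, -, hφ⟩ := exists_continuous_pos_dominating
    fun n => 1 + ∑ a ∈ A n, |a (x n)|
  let g : Cp X := φ.comp h
  have hg : g ∈ ⋃ n, ((A n : Set (Cp X)) + {f : Cp X | |f (x n)| < 1}) := hA ▸ Set.mem_univ g
  obtain ⟨n, hn⟩ := Set.mem_iUnion.1 hg
  obtain ⟨a, ha, f, hf, hfg⟩ := Set.mem_add.1 hn
  have h1 : 1 + ∑ a ∈ A n, |a (x n)| ≤ g (x n) := hφ n _ (hx n)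
  have h2 : g (x n) = a (x n) + f (x n) := by rw [← hfg]; rfl
  have h3 := Finset.single_le_sum (f := fun a : Cp X => |a (x n)|) (fun _ _ => abs_nonneg _) ha
  have h4 := le_abs_self (a (x n))
  have h5 := le_abs_self (f (x n))
  have h6 : |f (x n)| < 1 := hf
  linarith

end PointwiseConvergence

/-! ### Convergence and tightness properties. -/

section Tightness

variable {Y : Type*} [TopologicalSpace Y]

theorem FirstCountableTopology.strictlyFrechetUrysohn [FirstCountableTopology Y] :
    StrictlyFrechetUrysohn Y := by
  intro y A hA
  obtain ⟨U, hU⟩ := (𝓝 y).exists_antitone_basis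
  choose z hz using fun n => mem_closure_iff_nhds.1 (hA n) _ (hU.mem n)
  exact ⟨z, fun n => (hz n).2, hU.tendsto fun n => (hz n).1⟩

theorem StrictlyFrechetUrysohn.countableStrongFanTightness (h : StrictlyFrechetUrysohn Y) :
    CountableStrongFanTightness Y := by
  intro y A hA
  obtain ⟨z, hz, hlim⟩ := h y A hA
  exact ⟨z, hz, mem_closure_of_tendsto hlim (Eventually.of_forall fun n => Set.mem_range_self n)⟩

theorem CountableStrongFanTightness.countableFanTightness (h : CountableStrongFanTightness Y) :
    CountableFanTightness Y := by
  intro y A hA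
  obtain ⟨z, hz, hy⟩ := h y A hA
  refine ⟨fun n => {z n}, fun n => by simpa using hz n, ?_⟩
  simpa [Set.iUnion_singleton_eq_range] using hy

theorem CountableFanTightness.countableTightness (h : CountableFanTightness Y) :
    CountableTightness Y := by
  intro y A hA
  obtain ⟨B, hB, hy⟩ := h y (fun _ => A) fun _ => hA
  exact ⟨_, Set.iUnion_subset hB, Set.countable_iUnion fun n => (B n).countable_toSet, hy⟩

end Tightness

/-! ### From complete metrizability to hereditary Baireness. -/

section Completeness

variable {Y : Type*} [TopologicalSpace Y]

theorem TopologicalSpace.IsCompletelyMetrizableSpace.cechComplete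
    [TopologicalSpace.IsCompletelyMetrizableSpace Y] : CechComplete Y := by
  let := TopologicalSpace.upgradeIsCompletelyMetrizable Y
  refine ⟨inferInstance, ?_⟩
  -- `G n` is the union of the open sets whose trace on `Y` is small. At a point of every `G n` the
  -- neighbourhood filter traces a Cauchy filter on `Y`, and its limit maps to that point.
  let G : ℕ → Set (StoneCech Y) := fun n =>
    ⋃₀ {V | IsOpen V ∧ ∀ a b : Y, stoneCechUnit a ∈ V → stoneCechUnit b ∈ V →
      dist a b < 1 / ((n : ℝ) + 1)}
  have hG : ∀ n, IsOpen (G n) := fun n => isOpen_sUnion fun V hV => hV.1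
  suffices Set.range (stoneCechUnit : Y → StoneCech Y) = ⋂ n, G n by
    rw [this]
    exact IsGδ.iInter_of_isOpen hG
  apply Set.Subset.antisymm
  · rintro _ ⟨y, rfl⟩
    refine Set.mem_iInter.2 fun n => ?_
    have hpos : 0 < 1 / ((n : ℝ) + 1) / 2 := by positivity
    obtain ⟨V, hV, hVb⟩ := (isInducing_stoneCechUnit (X := Y)).isOpen_iff.1
      (Metric.isOpen_ball (x := y) (ε := 1 / ((n : ℝ) + 1) / 2))
    refine Set.mem_sUnion.2 ⟨V, ⟨hV, fun a b ha hb => ?_⟩, ?_⟩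
    · have ha' : a ∈ Metric.ball y (1 / ((n : ℝ) + 1) / 2) := hVb ▸ ha
      have hb' : b ∈ Metric.ball y (1 / ((n : ℝ) + 1) / 2) := hVb ▸ hb
      rw [Metric.mem_ball] at ha' hb'
      linarith [dist_triangle_right a b y]
    · have : y ∈ stoneCechUnit ⁻¹' V := hVb ▸ Metric.mem_ball_self hpos
      exact this
  · intro p hp
    have hne : (comap (stoneCechUnit : Y → StoneCech Y) (𝓝 p)).NeBot :=
      (isDenseInducing_stoneCechUnit (X := Y)).comap_nhds_neBot p
    have hcauchy : Cauchy (comap (stoneCechUnit : Y → StoneCech Y) (𝓝 p)) := by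
      refine Metric.cauchy_iff.2 ⟨hne, fun ε hε => ?_⟩
      obtain ⟨n, hn⟩ := exists_nat_one_div_lt hε
      obtain ⟨V, ⟨hVo, hV⟩, hpV⟩ := Set.mem_sUnion.1 (Set.mem_iInter.1 hp n)
      exact ⟨_, preimage_mem_comap (hVo.mem_nhds hpV),
        fun a ha b hb => (hV a b ha hb).trans hn⟩
    obtain ⟨y, hy⟩ := CompleteSpace.complete hcauchy
    exact ⟨y, tendsto_nhds_unique
      ((continuous_stoneCechUnit.tendsto y).mono_left hy) tendsto_comap⟩

/-- A closed `F` is the trace on `Y` of its closure in `StoneCech Y`, hence a `G_δ` in a compact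
Hausdorff space. -/
theorem CechComplete.hereditarilyBaire (h : CechComplete Y) : HereditarilyBaire Y := by
  obtain ⟨_, hG⟩ := h
  intro F hF
  let K : Set (StoneCech Y) := closure (stoneCechUnit '' F)
  have : CompactSpace K := isCompact_iff_compactSpace.1 isClosed_closure.isCompact
  let j : F → K := fun x => ⟨stoneCechUnit (x : Y), subset_closure ⟨x, x.2, rfl⟩⟩
  have hemb : IsEmbedding (stoneCechUnit : Y → StoneCech Y) := isEmbedding_stoneCechUnit
  have hj : IsEmbedding j := (hemb.comp IsEmbedding.subtypeVal).codRestrict K _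
  have hr : Set.range j = (↑) ⁻¹' Set.range (stoneCechUnit : Y → StoneCech Y) := by
    ext k
    constructor
    · rintro ⟨x, rfl⟩
      exact ⟨x, rfl⟩
    · rintro ⟨y, hy⟩
      have hyF : y ∈ F := by
        have : y ∈ stoneCechUnit ⁻¹' closure (stoneCechUnit '' F) := by
          rw [Set.mem_preimage, hy]
          exact k.2
        rwa [← hemb.isInducing.closure_eq_preimage_closure_image, hF.closure_eq] at this
      exact ⟨⟨y, hyF⟩, Subtype.ext hy⟩
  have hGj : IsGδ (Set.range j) := hr ▸ hG.preimage continuous_subtype_val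
  have : BaireSpace (Set.range j) := hGj.baireSpace_of_t2Space_locallyCompactSpace
  exact hj.toHomeomorph.symm.baireSpace

end Completeness

/-! ### The `m`-topology and pseudocompactness. -/

section MTopology

variable {X : Type*} [TopologicalSpace X]

/-- On a pseudocompact space the `m`-topology is the topology of uniform convergence. -/
theorem Pseudocompact.isCompletelyMetrizableSpace_cm (hX : Pseudocompact X) :
    TopologicalSpace.IsCompletelyMetrizableSpace (Cm X) := by
  let e : Cm X ≃ BoundedContinuousFunction X ℝ :=
    { toFun := fun f => BoundedContinuousFunction.ofNormedAddCommGroup f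
        (map_continuous (show C(X, ℝ) from f)) (hX f).choose (hX f).choose_spec
      invFun := fun f => f.toContinuousMap
      left_inv := fun f => rfl
      right_inv := fun f => rfl }
  have he : IsInducing e := by
    refine isInducing_iff_nhds.2 fun f => ?_
    -- Closed balls are given exactly by pointwise non-strict bounds; halving `δ` restores
    -- strictness.
    refine (Cm.nhds_hasBasis f).ext (Metric.nhds_basis_closedBall.comap e) ?_ ?_
    · intro ε hε
      obtain ⟨δ, hδ, hδε⟩ := hX.exists_pos_le ε hε
      refine ⟨δ / 2, half_pos hδ, fun g hg x => ?_⟩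
      have h1 : dist (g x) (f x) ≤ δ / 2 :=
        (BoundedContinuousFunction.dist_coe_le_dist (f := e g) (g := e f) x).trans hg
      rw [Real.dist_eq] at h1
      linarith [hδε x]
    · intro δ hδ
      refine ⟨ContinuousMap.const X δ, fun _ => hδ, fun g hg => ?_⟩
      exact (BoundedContinuousFunction.dist_le hδ.le).2 fun x => (hg x).le
  exact (e.toHomeomorphOfIsInducing he).isClosedEmbedding.IsCompletelyMetrizableSpace

/-- If `h` tends to infinity along the points `x n`, some strictly positive continuous function is
at most `c n` at `x n`, for any prescribed positive values `c n`. -/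
theorem exists_pos_le_of_seq {h : C(X, ℝ)} {x : ℕ → X} (hx : ∀ n : ℕ, (n : ℝ) ≤ h (x n))
    (c : ℕ → ℝ) (hc : ∀ n, 0 < c n) :
    ∃ ε : C(X, ℝ), (∀ y, 0 < ε y) ∧ ∀ n, ε (x n) ≤ c n := by
  obtain ⟨φ, hφ0, hφ⟩ := exists_continuous_pos_dominating fun n => (c n)⁻¹
  refine ⟨⟨fun y => (φ (h y))⁻¹, (φ.continuous.comp h.continuous).inv₀ fun y => (hφ0 _).ne'⟩,
    fun y => inv_pos.2 (hφ0 _), fun n => ?_⟩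
  exact inv_le_of_inv_le₀ (hc n) (hφ n _ (hx n))

/-- Strictly positive functions accumulate at `0`, but for countably many of them, `f n`, an `ε`
with `ε (x n) ≤ f n (x n)` excludes them all. -/
theorem CountableTightness.pseudocompact (hT : CountableTightness (Cm X)) : Pseudocompact X := by
  by_contra hX
  obtain ⟨h, x, hx⟩ := exists_seq_of_not_pseudocompact hX
  have h0 : ∀ y, (0 : Cm X) y = 0 := fun _ => rfl
  have hcl : (0 : Cm X) ∈ closure {f : Cm X | ∀ y, 0 < f y} := by
    refine (mem_closure_iff_nhds_basis (Cm.nhds_hasBasis _)).2 fun ε hε => ?_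
    refine ⟨((1 / 2 : ℝ) • ε : C(X, ℝ)), fun y => ?_, fun y => ?_⟩
    · change 0 < (1 / 2 : ℝ) * ε y
      linarith [hε y]
    · change |(1 / 2 : ℝ) * ε y - 0| < ε y
      rw [sub_zero, abs_of_pos] <;> linarith [hε y]
  obtain ⟨B, hBA, hB, h0B⟩ := hT 0 _ hcl
  have hBne : B.Nonempty := closure_nonempty_iff.1 ⟨_, h0B⟩
  obtain ⟨f, rfl⟩ := hB.exists_eq_range hBne
  have hf : ∀ n y, 0 < f n y := fun n => hBA (Set.mem_range_self n)
  obtain ⟨ε, hε, hεf⟩ := exists_pos_le_of_seq hx (fun n => f n (x n)) fun n => hf n _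
  obtain ⟨_, ⟨n, rfl⟩, hn⟩ := (mem_closure_iff_nhds_basis (Cm.nhds_hasBasis _)).1 h0B ε hε
  have h1 := hn (x n)
  rw [h0, sub_zero, abs_of_pos (hf n _)] at h1
  exact absurd (hεf n) (not_le.2 h1)

/-- The functions vanishing far out along `h` form a closed set in the `m`-topology. -/
theorem Cm.isClosed_setOf_eventually_zero (h : C(X, ℝ)) :
    IsClosed {f : Cm X | ∃ N : ℕ, ∀ y, (N : ℝ) ≤ h y → f y = 0} := by
  refine isOpen_compl_iff.1 fun f hf => ?_
  simp only [Set.mem_compl_iff, Set.mem_ofPred_eq, not_exists, not_forall] at hf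
  -- A function outside the set supplies its own points escaping along `h` at which it is nonzero.
  choose x hx hfx using hf
  obtain ⟨ε, hε, hεf⟩ := exists_pos_le_of_seq hx (fun n => |f (x n)|) fun n => abs_pos.2 (hfx n)
  refine ⟨ε, hε, fun g hg => ?_⟩
  rintro ⟨N, hN⟩
  have h1 := hg (x N)
  rw [hN _ (hx N), zero_sub, abs_neg] at h1
  exact absurd (hεf N) (not_le.2 h1)

theorem Cm.isClosed_setOf_zero_on (S : Set X) : IsClosed {f : Cm X | ∀ y ∈ S, f y = 0} := by
  refine isOpen_compl_iff.1 fun f hf => ?_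
  simp only [Set.mem_compl_iff, Set.mem_ofPred_eq, not_forall] at hf
  obtain ⟨y, hy, hfy⟩ := hf
  refine ⟨ContinuousMap.const X |f y|, fun _ => abs_pos.2 hfy, fun g hg hgS => ?_⟩
  have h1 := hg y
  rw [hgS y hy, zero_sub, abs_neg] at h1
  exact lt_irrefl _ h1

/-- The closed subspace `F` is a countable union of closed sets, indexed by `N`. None has interior
in `F`: a small bump at `x N` leaves the `N`-th set but not `F`. -/
theorem HereditarilyBaire.pseudocompact (hB : HereditarilyBaire (Cm X)) : Pseudocompact X := by
  by_contra hX
  obtain ⟨h, x, hx⟩ := exists_seq_of_not_pseudocompact hX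
  let F : Set (Cm X) := {f | ∃ N : ℕ, ∀ y, (N : ℝ) ≤ h y → f y = 0}
  have : BaireSpace F := hB F (Cm.isClosed_setOf_eventually_zero h)
  have : Nonempty F := ⟨⟨0, 0, fun _ _ => rfl⟩⟩
  obtain ⟨N, f, hf⟩ := nonempty_interior_of_iUnion_of_closed
    (f := fun N : ℕ => {f : F | ∀ y ∈ {y | (N : ℝ) ≤ h y}, (f : Cm X) y = 0})
    (fun N => (Cm.isClosed_setOf_zero_on _).preimage continuous_subtype_val)
    (Set.eq_univ_of_forall fun f => Set.mem_iUnion.2 f.2)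
  have hf' := mem_interior_iff_mem_nhds.1 hf
  rw [nhds_subtype] at hf'
  obtain ⟨ε, hε, hεN⟩ := ((Cm.nhds_hasBasis (f : Cm X)).comap _).mem_iff.1 hf'
  let M : ℝ := h (x N) + 1
  -- The cutoff equals `1` at `x N` and `0` where `h ≥ M`, so adding `b` stays in `F`; the factor `ε
  -- / 2` keeps the sum in `W(f, ε)`.
  let b : C(X, ℝ) := ⟨fun y => ε y / 2 * min 1 (max 0 (M - h y)), by fun_prop⟩
  let f₀ : C(X, ℝ) := (f : Cm X)
  let g : Cm X := f₀ + b
  have hgy : ∀ y, g y = (f : Cm X) y + ε y / 2 * min 1 (max 0 (M - h y)) := fun _ => rfl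
  obtain ⟨K, hK⟩ := f.2
  have hgF : g ∈ F := by
    obtain ⟨L, hL⟩ := exists_nat_ge M
    refine ⟨max K L, fun y hy => ?_⟩
    rw [Nat.cast_max, max_le_iff] at hy
    rw [hgy, hK y hy.1, max_eq_left (by linarith [hy.2]), min_eq_right zero_le_one]
    simp
  have hgW : g ∈ Cm.W (f : Cm X) ε := by
    intro y
    have hm0 : 0 ≤ min 1 (max 0 (M - h y)) := le_min zero_le_one (le_max_left _ _)
    have hm1 : min 1 (max 0 (M - h y)) ≤ 1 := min_le_left _ _
    rw [hgy, add_sub_cancel_left, abs_of_nonneg (mul_nonneg (half_pos (hε y)).le hm0)]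
    nlinarith [hε y]
  have h1 : g (x N) = 0 := hεN (show (⟨g, hgF⟩ : F) ∈ _ from hgW) _ (hx N)
  have h2 : (f : Cm X) (x N) = 0 := interior_subset hf _ (hx N)
  rw [hgy, h2, show M - h (x N) = 1 by simp [M]] at h1
  norm_num at h1
  exact (hε _).ne' h1

end MTopology

theorem theorem2p2 (X : Type*) [TopologicalSpace X] [T35Space X] :
    List.TFAE [
      StrictlyHBounded (Cp X),
      HBounded (Cp X),
      StrictlyMBounded (Cp X),
      MBounded (Cp X),
      Pseudocompact X,
      FirstCountableTopology (Cm X),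
      StrictlyFrechetUrysohn (Cm X),
      CountableStrongFanTightness (Cm X),
      CountableFanTightness (Cm X),
      CountableTightness (Cm X),
      TopologicalSpace.IsCompletelyMetrizableSpace (Cm X),
      CechComplete (Cm X),
      HereditarilyBaire (Cm X)] := by
  tfae_have 1 → 2 := StrictlyHBounded.hBounded
  tfae_have 1 → 3 := StrictlyHBounded.strictlyMBounded
  tfae_have 2 → 4 := HBounded.mBounded
  tfae_have 3 → 4 := StrictlyMBounded.mBounded
  tfae_have 4 → 5 := MBounded.pseudocompact
  tfae_have 5 → 1 := Pseudocompact.strictlyHBounded_cp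
  tfae_have 5 → 11 := Pseudocompact.isCompletelyMetrizableSpace_cm
  tfae_have 11 → 6 := fun _ => inferInstance
  tfae_have 6 → 7 := fun _ => FirstCountableTopology.strictlyFrechetUrysohn
  tfae_have 7 → 8 := StrictlyFrechetUrysohn.countableStrongFanTightness
  tfae_have 8 → 9 := CountableStrongFanTightness.countableFanTightness
  tfae_have 9 → 10 := CountableFanTightness.countableTightness
  tfae_have 10 → 5 := CountableTightness.pseudocompact
  tfae_have 11 → 12 := fun _ => TopologicalSpace.IsCompletelyMetrizableSpace.cechComplete
  tfae_have 12 → 13 := CechComplete.hereditarilyBaire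
  tfae_have 13 → 5 := HereditarilyBaire.pseudocompact
  tfae_finish
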